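/- Let $n\ge 2$, $\tau\ge 0$ and $\alpha\in\mathbb R$. A 4-tuple $\sigma=(A,N,b,c)$ with $A,N\in\mathbb R^{n\times n}$, $b\in\mathbb R^{n\times 1}$, $c\in\mathbb R^{1\times n}$ determines the $n$-dimensional bilinear system of type II $$\dot x=(A+uN)x,\qquad x(0)=b,\qquad y=cx .$$ An input is a Lebesgue measurable, essentially bounded function $u:[0,T_u]\to\mathbb R$, where $T_u\ge 0$ may depend on $u$. Two systems are i/o equivalent with respect to a set $\mathcal U$ of inputs if for every $u\in\mathcal U$ their outputs $y(t)$ under $u$ agree for all $t\in[0,T_u]$; they are i/o equivalent if this holds with $\mathcal U$ the set of all inputs. Let $\mathcal I_{\tau,\alpha}$ be the set of all inputs of the form $$u(t)=\alpha\ \text{ for } 0\le t<\tau,\qquad u(t)=\beta\ \text{ for } \tau\le t\le T,$$ with $\beta\in\mathbb R$ and $T>\tau$ arbitrary. A set of $n$-dimensional systems is called generic if the corresponding set of 4-tuples is open and dense in $\mathbb R^{2n^2+2n}$ and its complement has Lebesgue measure zero. Then there is a generic set $\mathcal G$ of $n$-dimensional bilinear systems of type II such that for every $\sigma\in\mathcal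 G$ there is some $\widehat\sigma\in\mathcal G$ for which 1. $\sigma$ and $\widehat\sigma$ are i/o equivalent with respect to all inputs in $\mathcal I_{\tau,\alpha}$, but 2. $\sigma$ and $\widehat\sigma$ are not i/o equivalent. -/

import Mathlib

open MeasureTheory Set

open scoped ENNReal

namespace Bilinear

/-- The 4-tuples `(A, N, b, c)` of dimension `n`: two real `n × n` matrices, a column and a row.
Its product topology and product (Lebesgue) volume are those of `ℝ ^ (2 * n ^ 2 + 2 * n)`.
A 4-tuple stands for the system of type II `x' = (A + u N) x`, `x 0 = b`, `y = c x`. -/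
abbrev FourTuple (n : ℕ) : Type :=
  (Fin n → Fin n → ℝ) × (Fin n → Fin n → ℝ) × (Fin n → ℝ) × (Fin n → ℝ)

namespace FourTuple

variable {n : ℕ}

/-- The drift matrix `A`. -/
def A (σ : FourTuple n) : Matrix (Fin n) (Fin n) ℝ := Matrix.of σ.1

/-- The matrix `N` multiplying the input. -/
def N (σ : FourTuple n) : Matrix (Fin n) (Fin n) ℝ := Matrix.of σ.2.1

/-- The initial state `b`. -/
def b (σ : FourTuple n) : Fin n → ℝ := σ.2.2.1

/-- The output row `c`. -/
def c (σ : FourTuple n) : Fin n → ℝ := σ.2.2.2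

end FourTuple

/-- A generic set of 4-tuples: open, dense, and with a complement of Lebesgue measure zero. -/
def IsGeneric {n : ℕ} (S : Set (FourTuple n)) : Prop :=
  IsOpen S ∧ Dense S ∧ volume Sᶜ = 0

/-- An input: a Lebesgue measurable, essentially bounded function on an interval `[0, T]`.
Only the values of `toFun` on `[0, T]` matter. -/
structure Input where
  /-- the length of the interval of definition -/
  T : ℝ
  T_nonneg : 0 ≤ T
  /-- the values of the input -/
  toFun : ℝ → ℝ
  memLp_top : MemLp toFun ∞ (volume.restrict (Icc 0 T))

instance : CoeFun Input (fun _ => ℝ → ℝ) := ⟨Input.toFun⟩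

/-- `x` is a (Carathéodory) solution on `[0, T]` of `x' = (A + u N) x`, `x 0 = b`,
written as the equivalent integral equation. -/
def IsSolution {n : ℕ} (σ : FourTuple n) (u : Input) (x : ℝ → Fin n → ℝ) : Prop :=
  ContinuousOn x (Icc 0 u.T) ∧
    ∀ t ∈ Icc 0 u.T, x t = σ.b + ∫ s in (0 : ℝ)..t, (σ.A + u s • σ.N).mulVec (x s)

section Existence

variable {E : Type*} [NormedAddCommGroup E] [NormedSpace ℝ E]

theorem norm_integral_iterate_le {T L C : ℝ} {M : ℝ → E →L[ℝ] E} {g : ℝ → E} {k : ℕ}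
    (hL : 0 ≤ L) (hM : ∀ᵐ s ∂volume.restrict (Icc 0 T), ‖M s‖ ≤ L)
    (hg : ∀ t ∈ Icc 0 T, ‖g t‖ ≤ C * ((L * t) ^ k / (k.factorial : ℝ))) {t : ℝ}
    (ht : t ∈ Icc 0 T) :
    ‖∫ s in (0 : ℝ)..t, M s (g s)‖ ≤ C * ((L * t) ^ (k + 1) / ((k + 1).factorial : ℝ)) := by
  have h1 : ‖∫ s in (0 : ℝ)..t, M s (g s)‖ ≤
      ∫ s in (0 : ℝ)..t, (C * L ^ (k + 1) / (k.factorial : ℝ)) * s ^ k := by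
    refine intervalIntegral.norm_integral_le_of_norm_le ht.1 ?_
      (Continuous.intervalIntegrable (by fun_prop) _ _)
    filter_upwards [(ae_restrict_iff' measurableSet_Icc).1 hM] with s hs hst
    have hs' : s ∈ Icc 0 T := ⟨hst.1.le, hst.2.trans ht.2⟩
    calc ‖M s (g s)‖ ≤ ‖M s‖ * ‖g s‖ := (M s).le_opNorm _
      _ ≤ L * (C * ((L * s) ^ k / (k.factorial : ℝ))) :=
        mul_le_mul (hs hs') (hg s hs') (norm_nonneg _) hL
      _ = _ := by rw [mul_pow, pow_succ]; ring
  refine h1.trans (le_of_eq ?_)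
  rw [intervalIntegral.integral_const_mul, integral_pow, Nat.factorial_succ]
  push_cast
  have := Nat.factorial_ne_zero k
  field_simp
  ring

theorem integrableOn_clm_apply {T L : ℝ} {M : ℝ → E →L[ℝ] E} {g : ℝ → E}
    (hMm : AEStronglyMeasurable M (volume.restrict (Icc 0 T)))
    (hM : ∀ᵐ s ∂volume.restrict (Icc 0 T), ‖M s‖ ≤ L) (hg : ContinuousOn g (Icc 0 T)) :
    IntegrableOn (fun s => M s (g s)) (Icc 0 T) := by
  have hgi : IntegrableOn g (Icc 0 T) := hg.integrableOn_compact isCompact_Icc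
  refine Integrable.mono' (hgi.norm.const_mul L)
    ((ContinuousLinearMap.id ℝ (E →L[ℝ] E)).aestronglyMeasurable_comp₂ hMm
      hgi.aestronglyMeasurable) ?_
  filter_upwards [hM] with s hs
  exact (M s).le_of_opNorm_le hs _

/-- The terms of the Peano-Baker series. -/
noncomputable def iterate (M : ℝ → E →L[ℝ] E) (x₀ : E) : ℕ → ℝ → E
  | 0 => fun _ => x₀
  | k + 1 => fun t => ∫ s in (0 : ℝ)..t, M s (iterate M x₀ k s)

theorem exists_solution_aux [CompleteSpace E] {T L : ℝ} (hT : 0 ≤ T) {M : ℝ → E →L[ℝ] E}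
    (hMm : AEStronglyMeasurable M (volume.restrict (Icc 0 T))) (hL : 0 ≤ L)
    (hM : ∀ᵐ s ∂volume.restrict (Icc 0 T), ‖M s‖ ≤ L) (x₀ : E) :
    ∃ x : ℝ → E, ContinuousOn x (Icc 0 T) ∧
      ∀ t ∈ Icc 0 T, x t = x₀ + ∫ s in (0 : ℝ)..t, M s (x s) := by
  set f := iterate M x₀ with hf
  have hb : ∀ k, ∀ t ∈ Icc 0 T, ‖f k t‖ ≤ ‖x₀‖ * ((L * t) ^ k / (k.factorial : ℝ)) := by
    intro k
    induction k with
    | zero => intro t _; simp [hf, iterate]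
    | succ k ih => intro t ht; exact norm_integral_iterate_le hL hM ih ht
  have hc : ∀ k, ContinuousOn (f k) (Icc 0 T) := by
    intro k
    induction k with
    | zero => exact continuousOn_const
    | succ k ih =>
      have := intervalIntegral.continuousOn_primitive_interval (μ := volume) (a := 0) (b := T)
        (f := fun s => M s (f k s))
        (by rw [uIcc_of_le hT]; exact integrableOn_clm_apply hMm hM ih)
      rwa [uIcc_of_le hT] at this
  have hs : Summable fun k : ℕ => ‖x₀‖ * ((L * T) ^ k / (k.factorial : ℝ)) :=
    (Real.summable_pow_div_factorial _).mul_left _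
  have hb' : ∀ k, ∀ t ∈ Icc 0 T, ‖f k t‖ ≤ ‖x₀‖ * ((L * T) ^ k / (k.factorial : ℝ)) := by
    intro k t ht
    refine (hb k t ht).trans ?_
    have h0 := ht.1
    have h1 := ht.2
    gcongr
  have hsum : ∀ t ∈ Icc 0 T, Summable fun k => f k t := fun t ht =>
    Summable.of_norm_bounded hs (fun k => hb' k t ht)
  refine ⟨fun t => ∑' k, f k t, continuousOn_tsum hc hs hb', fun t ht => ?_⟩
  have hsub : uIoc 0 t ⊆ Icc 0 T := by
    rw [uIoc_of_le ht.1]; exact fun s hs => ⟨hs.1.le, hs.2.trans ht.2⟩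
  have key : HasSum (fun k => ∫ s in (0 : ℝ)..t, M s (f k s))
      (∫ s in (0 : ℝ)..t, M s (∑' k, f k s)) := by
    refine intervalIntegral.hasSum_integral_of_dominated_convergence
      (fun k _ => L * (‖x₀‖ * ((L * T) ^ k / (k.factorial : ℝ)))) (fun k => ?_) (fun k => ?_) ?_
      ?_ ?_
    · exact ((integrableOn_clm_apply hMm hM (hc k)).mono_set hsub).aestronglyMeasurable
    · filter_upwards [(ae_restrict_iff' measurableSet_Icc).1 hM] with s hs hst
      exact (M s).le_of_opNorm_le_of_le (hs (hsub hst)) (hb' k s (hsub hst))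
    · exact Filter.Eventually.of_forall fun s _ => hs.mul_left L
    · exact intervalIntegrable_const
    · exact Filter.Eventually.of_forall fun s hs => (M s).hasSum (hsum s (hsub hs)).hasSum
  have h2 : ∑' k, f (k + 1) t = ∫ s in (0 : ℝ)..t, M s (∑' k, f k s) := key.tsum_eq
  change ∑' k, f k t = _
  rw [(hsum t ht).tsum_eq_zero_add, h2]
  rfl

theorem unique_solution_aux {T L : ℝ} {M : ℝ → E →L[ℝ] E}
    (hMm : AEStronglyMeasurable M (volume.restrict (Icc 0 T))) (hL : 0 ≤ L)
    (hM : ∀ᵐ s ∂volume.restrict (Icc 0 T), ‖M s‖ ≤ L) {x₀ : E} {x z : ℝ → E}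
    (hxc : ContinuousOn x (Icc 0 T)) (hzc : ContinuousOn z (Icc 0 T))
    (hx : ∀ t ∈ Icc 0 T, x t = x₀ + ∫ s in (0 : ℝ)..t, M s (x s))
    (hz : ∀ t ∈ Icc 0 T, z t = x₀ + ∫ s in (0 : ℝ)..t, M s (z s)) : EqOn x z (Icc 0 T) := by
  obtain ⟨C, hC⟩ := isCompact_Icc.exists_bound_of_continuousOn (hxc.sub hzc)
  have hd : ∀ t ∈ Icc 0 T, x t - z t = ∫ s in (0 : ℝ)..t, M s (x s - z s) := by
    intro t ht
    have hsub : uIcc 0 t ⊆ Icc 0 T := by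
      rw [uIcc_of_le ht.1]; exact Icc_subset_Icc_right ht.2
    have e1 := ((integrableOn_clm_apply hMm hM hxc).mono_set hsub).intervalIntegrable
    have e2 := ((integrableOn_clm_apply hMm hM hzc).mono_set hsub).intervalIntegrable
    simp only [map_sub]
    rw [intervalIntegral.integral_sub e1 e2, hx t ht, hz t ht]
    abel
  have hk : ∀ k : ℕ, ∀ t ∈ Icc 0 T, ‖x t - z t‖ ≤ C * ((L * t) ^ k / (k.factorial : ℝ)) := by
    intro k
    induction k with
    | zero => intro t ht; simpa using hC t ht
    | succ k ih => intro t ht; rw [hd t ht]; exact norm_integral_iterate_le hL hM ih ht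
  intro t ht
  have h0 : Filter.Tendsto (fun k : ℕ => C * ((L * t) ^ k / (k.factorial : ℝ))) Filter.atTop
      (nhds (C * 0)) := (FloorSemiring.tendsto_pow_div_factorial_atTop (L * t)).const_mul C
  have h1 := ge_of_tendsto' h0 (fun k => hk k t ht)
  rw [mul_zero, norm_le_zero_iff, sub_eq_zero] at h1
  exact h1

end Existence

/-- `A + v N` as a continuous linear map. -/
noncomputable def clm {n : ℕ} (σ : FourTuple n) (v : ℝ) : (Fin n → ℝ) →L[ℝ] (Fin n → ℝ) :=
  LinearMap.toContinuousLinearMap (Matrix.toLin' σ.A) +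
    v • LinearMap.toContinuousLinearMap (Matrix.toLin' σ.N)

theorem clm_apply {n : ℕ} (σ : FourTuple n) (v : ℝ) (x : Fin n → ℝ) :
    clm σ v x = (σ.A + v • σ.N).mulVec x := by
  simp [clm, Matrix.add_mulVec, Matrix.smul_mulVec]

theorem clm_aestronglyMeasurable {n : ℕ} (σ : FourTuple n) (u : Input) :
    AEStronglyMeasurable (fun s => clm σ (u s)) (volume.restrict (Icc 0 u.T)) :=
  (u.memLp_top.1.smul_const _).const_add _

theorem clm_bound {n : ℕ} (σ : FourTuple n) (u : Input) :
    ∃ L : ℝ, 0 ≤ L ∧ ∀ᵐ s ∂volume.restrict (Icc 0 u.T), ‖clm σ (u s)‖ ≤ L := by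
  have h := u.memLp_top.2
  rw [eLpNorm_exponent_top] at h
  refine ⟨‖LinearMap.toContinuousLinearMap (Matrix.toLin' σ.A)‖ +
    (eLpNormEssSup u.toFun (volume.restrict (Icc 0 u.T))).toReal *
      ‖LinearMap.toContinuousLinearMap (Matrix.toLin' σ.N)‖, by positivity, ?_⟩
  filter_upwards [ae_le_eLpNormEssSup (f := u.toFun) (μ := volume.restrict (Icc 0 u.T))] with s hs
  have hs' : ‖u s‖ ≤ (eLpNormEssSup u.toFun (volume.restrict (Icc 0 u.T))).toReal := by
    rw [← toReal_enorm]
    exact ENNReal.toReal_mono h.ne hs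
  refine (norm_add_le _ _).trans ?_
  rw [norm_smul]
  gcongr

/-- Every input has a solution. -/
theorem exists_isSolution {n : ℕ} (σ : FourTuple n) (u : Input) : ∃ x, IsSolution σ u x := by
  obtain ⟨L, hL, hM⟩ := clm_bound σ u
  obtain ⟨x, hx, hx'⟩ :=
    exists_solution_aux u.T_nonneg (clm_aestronglyMeasurable σ u) hL hM σ.b
  exact ⟨x, hx, by simpa only [clm_apply] using hx'⟩

/-- The solution is unique on the interval of definition of the input. -/
theorem IsSolution.eqOn {n : ℕ} {σ : FourTuple n} {u : Input} {x z : ℝ → Fin n → ℝ}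
    (hx : IsSolution σ u x) (hz : IsSolution σ u z) : EqOn x z (Icc 0 u.T) := by
  obtain ⟨L, hL, hM⟩ := clm_bound σ u
  exact unique_solution_aux (clm_aestronglyMeasurable σ u) hL hM hx.1 hz.1
    (by simpa only [clm_apply] using hx.2) (by simpa only [clm_apply] using hz.2)

/-- The state trajectory `φ(·, u)` of the system under the input `u`
(meaningful on `[0, T]`, where it is the unique solution). -/
noncomputable def trajectory {n : ℕ} (σ : FourTuple n) (u : Input) : ℝ → Fin n → ℝ :=
  Classical.choose (exists_isSolution σ u)

theorem trajectory_isSolution {n : ℕ} (σ : FourTuple n) (u : Input) :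
    IsSolution σ u (trajectory σ u) :=
  Classical.choose_spec (exists_isSolution σ u)

/-- The output `y t = c x(t)` of the system under the input `u`. -/
noncomputable def output {n : ℕ} (σ : FourTuple n) (u : Input) (t : ℝ) : ℝ :=
  σ.c ⬝ᵥ trajectory σ u t

/-- Two systems are i/o equivalent with respect to all inputs in `U` if no input in `U`
distinguishes between their outputs. -/
def IOEquivOn {n m : ℕ} (U : Set Input) (σ : FourTuple n) (σ' : FourTuple m) : Prop :=
  ∀ u ∈ U, ∀ t ∈ Icc 0 u.T, output σ u t = output σ' u t

/-- Two systems are i/o equivalent if no input whatsoever distinguishes between their outputs. -/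
def IOEquiv {n m : ℕ} (σ : FourTuple n) (σ' : FourTuple m) : Prop :=
  IOEquivOn univ σ σ'

/-- The class `I_{τ,α}` of the inputs, on the intervals `[0, T]` with `T > τ`, that are equal
to `α` for `0 ≤ t < τ` and to an arbitrary constant `β` for `τ ≤ t ≤ T`. -/
def pulses (τ α : ℝ) : Set Input :=
  {u | τ < u.T ∧ ∃ β : ℝ, ∀ t ∈ Icc 0 u.T, u t = if t < τ then α else β}

end Bilinear

/-! Write `M = A + αN`. The partner of a system is its transpose with the initial state replaced by
`c exp(-τM)` and the output row by `exp(τM) b`. Transposing a scalar reverses a product of flows,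
and the two corrections restore the order for inputs in `pulses τ α`: after time `τ` the partner's
output is `c exp(-τM) exp(τM) exp((t-τ)(A+βN)) exp(τM) b`, where the first two factors cancel.
General inputs determine the number `c A N b`, whose value for the partner is `c exp(-τM) N A
exp(τM) b`. The generic set is where these two numbers differ. It is stable under the pairing, which
is an involution, and it is the nonvanishing set of an analytic function that is nonzero at an
explicit example. -/

namespace Bilinear

open NormedSpace Matrix Filter Topology

/-! ### Zero sets of analytic functions and genericity -/

section NullSets

variable {E : Type*} [NormedAddCommGroup E] [NormedSpace ℝ E] [FiniteDimensional ℝ E]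
  [MeasurableSpace E] [BorelSpace E]

/-- A measurable set that meets every line through a given point in a null set is null. -/
theorem measure_eq_zero_of_forall_line (μ : Measure E) [μ.IsAddHaarMeasure] {S : Set E}
    (hS : MeasurableSet S) (x : E) (h : ∀ v : E, ∀ᵐ t : ℝ, x + t • v ∉ S) : μ S = 0 := by
  have hm : MeasurableSet {p : E × ℝ | x + p.2 • p.1 ∉ S} := by
    have : Measurable fun p : E × ℝ => x + p.2 • p.1 :=
      Continuous.measurable (by fun_prop)
    exact this hS.compl
  -- By Fubini some `t ≠ 0` works for almost every `v`. Then `S` is the image of a null set under a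
  -- homothety and a translation.
  have h1 : ∀ᵐ t : ℝ, ∀ᵐ v ∂μ, x + t • v ∉ S :=
    (Measure.ae_ae_comm (p := fun v t => x + t • v ∉ S) hm).1 (Eventually.of_forall h)
  have h2 : ∀ᵐ t : ℝ, t ≠ 0 := by simp [ae_iff]
  obtain ⟨t, ht, ht0⟩ := (h1.and h2).exists
  have h3 : μ ((t • ·) ⁻¹' ((x + ·) ⁻¹' S)) = 0 := by
    simpa [ae_iff, Set.preimage] using ht
  rw [Measure.addHaar_preimage_smul _ ht0, measure_preimage_add] at h3
  refine (mul_eq_zero.1 h3).resolve_left ?_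
  simp [ht0]

/-- The zero set of a real analytic function that does not vanish identically is null. -/
theorem measure_zeros_eq_zero (μ : Measure E) [μ.IsAddHaarMeasure] {f : E → ℝ}
    (hf : AnalyticOnNhd ℝ f univ) {x : E} (hx : f x ≠ 0) : μ {y | f y = 0} = 0 := by
  have hc : Continuous f := continuousOn_univ.1 hf.continuousOn
  refine measure_eq_zero_of_forall_line μ (isClosed_eq hc continuous_const).measurableSet x
    fun v => ?_
  have hg : AnalyticOnNhd ℝ (fun t : ℝ => f (x + t • v)) univ := fun t _ =>
    (hf (x + t • v) (mem_univ _)).fun_comp (f := fun t : ℝ => x + t • v) (by fun_prop)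
  -- On each line through `x` the function is nonzero at `t = 0`, so its zeros there are isolated.
  have := hg.preimage_zero_mem_codiscrete (x := 0) (by simpa using hx)
  have h := ae_restrict_le_codiscreteWithin (μ := volume) MeasurableSet.univ this
  rw [Measure.restrict_univ] at h
  exact h

end NullSets

instance isAddHaarMeasure_volume (n : ℕ) :
    (volume : Measure (FourTuple n)).IsAddHaarMeasure := by
  have h1 : (volume : Measure (Fin n → Fin n → ℝ)).IsAddHaarMeasure :=
    Measure.pi.isAddHaarMeasure fun _ => volume
  have h2 : (volume : Measure ((Fin n → ℝ) × (Fin n → ℝ))).IsAddHaarMeasure :=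
    Measure.prod.instIsAddHaarMeasure volume volume
  have h3 : (volume : Measure ((Fin n → Fin n → ℝ) × (Fin n → ℝ) × (Fin n → ℝ))).IsAddHaarMeasure :=
    Measure.prod.instIsAddHaarMeasure volume volume
  exact Measure.prod.instIsAddHaarMeasure volume volume

/-- Density follows from the null complement, since nonempty open sets have positive volume. -/
theorem isGeneric_of_analytic {n : ℕ} {f : FourTuple n → ℝ} (hf : AnalyticOnNhd ℝ f univ)
    {σ : FourTuple n} (hσ : f σ ≠ 0) : IsGeneric {σ | f σ ≠ 0} := by
  have hc : Continuous f := continuousOn_univ.1 hf.continuousOn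
  have h0 : volume {σ | f σ ≠ 0}ᶜ = 0 := by
    have : {σ | f σ ≠ 0}ᶜ = {σ | f σ = 0} := by ext; simp
    rw [this]
    exact measure_zeros_eq_zero volume hf hσ
  refine ⟨isOpen_ne_fun hc continuous_const, ?_, h0⟩
  have : ∀ᵐ σ : FourTuple n, σ ∈ {σ | f σ ≠ 0} := h0
  exact Measure.dense_of_ae this

/-! ### Response to two-step inputs -/

variable {n : ℕ}

/-- The transition matrix of the system over a time `t` under the constant input `v`. -/
noncomputable def flow (σ : FourTuple n) (v t : ℝ) : Matrix (Fin n) (Fin n) ℝ :=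
  exp (t • (σ.A + v • σ.N))

@[simp]
theorem flow_zero (σ : FourTuple n) (v : ℝ) : flow σ v 0 = 1 := by
  simp [flow]

theorem flow_add (σ : FourTuple n) (v s t : ℝ) : flow σ v (s + t) = flow σ v s * flow σ v t := by
  rw [flow, add_smul]
  exact Matrix.exp_add_of_commute _ _ ((Commute.refl _).smul_left _ |>.smul_right _)

theorem hasDerivAt_flow_mulVec (σ : FourTuple n) (v : ℝ) (x : Fin n → ℝ) (t : ℝ) :
    HasDerivAt (fun t => flow σ v t *ᵥ x) ((σ.A + v • σ.N) *ᵥ (flow σ v t *ᵥ x)) t := by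
  open scoped Matrix.Norms.Operator in
  have h := hasDerivAt_exp_smul_const' (𝕂 := ℝ) (σ.A + v • σ.N) t
  let L : Matrix (Fin n) (Fin n) ℝ →L[ℝ] (Fin n → ℝ) :=
    LinearMap.toContinuousLinearMap ((Matrix.mulVecBilin ℝ ℝ).flip x)
  have h2 := L.hasFDerivAt.comp_hasDerivAt t h
  rw [Matrix.mulVec_mulVec]
  exact h2

theorem continuous_flow_mulVec (σ : FourTuple n) (v : ℝ) :
    Continuous fun p : ℝ × (Fin n → ℝ) => flow σ v p.1 *ᵥ p.2 := by
  open scoped Matrix.Norms.Operator in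
  have h : Continuous fun t => flow σ v t := by
    unfold flow
    exact NormedSpace.exp_continuous.comp (by fun_prop)
  exact Continuous.matrix_mulVec (h.comp continuous_fst) continuous_snd

/-- The state under an input that takes a value `v` before the time `s` and a value `w` after. -/
theorem trajectory_step (σ : FourTuple n) {u : Input} {s v w : ℝ} (hs : 0 ≤ s)
    (hu : ∀ t ∈ Icc 0 u.T, u t = if t < s then v else w) {t : ℝ} (ht : t ∈ Icc 0 u.T) :
    trajectory σ u t = flow σ w (max (t - s) 0) *ᵥ (flow σ v (min t s) *ᵥ σ.b) := by
  -- The truncations merge both phases: before `s` the left factor is the identity, after `s` the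
  -- right one is frozen.
  set x : ℝ → Fin n → ℝ := fun t => flow σ w (max (t - s) 0) *ᵥ (flow σ v (min t s) *ᵥ σ.b)
    with hx
  have hxc : Continuous x :=
    (continuous_flow_mulVec σ w).comp (.prodMk (by fun_prop)
      ((continuous_flow_mulVec σ v).comp (.prodMk (by fun_prop) continuous_const)))
  have hd : ∀ t ∈ Ioo 0 u.T, t ≠ s → HasDerivAt x ((σ.A + u t • σ.N) *ᵥ x t) t := by
    intro t ht hts
    rw [hu t ⟨ht.1.le, ht.2.le⟩]
    rcases lt_or_gt_of_ne hts with h | h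
    · have e : ∀ r < s, x r = flow σ v r *ᵥ σ.b := fun r hr => by
        simp [hx, max_eq_right (sub_nonpos.2 hr.le), min_eq_left hr.le]
      rw [if_pos h, e t h]
      exact (hasDerivAt_flow_mulVec σ v σ.b t).congr_of_eventuallyEq
        ((eventually_lt_nhds h).mono e)
    · have e : ∀ r > s, x r = flow σ w (r - s) *ᵥ (flow σ v s *ᵥ σ.b) := fun r hr => by
        simp [hx, max_eq_left (sub_nonneg.2 hr.le), min_eq_right hr.le]
      rw [if_neg h.not_gt, e t h]
      exact ((hasDerivAt_flow_mulVec σ w _ (t - s)).comp_sub_const t s).congr_of_eventuallyEq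
        ((eventually_gt_nhds h).mono e)
  have hsol : IsSolution σ u x := by
    refine ⟨hxc.continuousOn, fun t ht => ?_⟩
    obtain ⟨L, -, hL⟩ := clm_bound σ u
    have hsub : uIcc 0 t ⊆ Icc 0 u.T := by
      rw [uIcc_of_le ht.1]; exact Icc_subset_Icc_right ht.2
    have hi : IntervalIntegrable (fun r => (σ.A + u r • σ.N) *ᵥ x r) volume 0 t := by
      have := ((integrableOn_clm_apply (clm_aestronglyMeasurable σ u) hL
        hxc.continuousOn).mono_set hsub).intervalIntegrable
      simpa only [clm_apply] using this
    have h0 : x 0 = σ.b := by simp [hx, hs]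
    -- The switching time `s` is the only point where differentiability may fail.
    rw [integral_eq_of_hasDerivAt_off_countable_of_le x _ ht.1 (countable_singleton s)
      hxc.continuousOn (fun r hr => hd r ⟨hr.1.1, hr.1.2.trans_le ht.2⟩ hr.2) hi, h0]
    abel
  exact (trajectory_isSolution σ u).eqOn hsol ht

theorem output_step (σ : FourTuple n) {u : Input} {s v w : ℝ} (hs : 0 ≤ s)
    (hu : ∀ t ∈ Icc 0 u.T, u t = if t < s then v else w) {t : ℝ} (ht : t ∈ Icc 0 u.T) :
    output σ u t = σ.c ⬝ᵥ flow σ w (max (t - s) 0) *ᵥ flow σ v (min t s) *ᵥ σ.b := by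
  rw [output, trajectory_step σ hs hu ht]

/-- The input on `[0, s + r]` with the value `v` before the time `s` and `w` after. -/
noncomputable def stepInput (s r v w : ℝ) (h : 0 ≤ s + r) : Input where
  T := s + r
  T_nonneg := h
  toFun t := if t < s then v else w
  memLp_top := by
    refine memLp_top_of_bound (C := max ‖v‖ ‖w‖)
      (Measurable.ite measurableSet_Iio measurable_const
        measurable_const).aestronglyMeasurable (Eventually.of_forall fun t => ?_)
    split_ifs <;> simp

/-! ### An invariant of i/o equivalence -/

theorem eq_of_hasDerivAt_of_eqOn_Ici {f g : ℝ → ℝ} {a b : ℝ} (hf : HasDerivAt f a 0)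
    (hg : HasDerivAt g b 0) (h : EqOn f g (Ici 0)) : a = b :=
  (uniqueDiffWithinAt_Ici (0 : ℝ)).eq_deriv _ hf.hasDerivWithinAt
    (hg.hasDerivWithinAt.congr h (h self_mem_Ici))

theorem hasDerivAt_dotProduct_flow (σ : FourTuple n) (v : ℝ) (y x : Fin n → ℝ) :
    HasDerivAt (fun t => y ⬝ᵥ flow σ v t *ᵥ x) (y ⬝ᵥ (σ.A + v • σ.N) *ᵥ x) 0 := by
  let L : (Fin n → ℝ) →L[ℝ] ℝ := LinearMap.toContinuousLinearMap (dotProductBilin ℝ ℝ y)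
  have h := L.hasFDerivAt.comp_hasDerivAt 0 (hasDerivAt_flow_mulVec σ v x 0)
  rw [flow_zero, one_mulVec] at h
  exact h

/-- Input/output equivalent systems have the same coefficient `c A N b`. -/
theorem IOEquiv.coeff_eq {m : ℕ} {σ : FourTuple n} {σ' : FourTuple m} (h : IOEquiv σ σ') :
    σ.c ⬝ᵥ σ.A *ᵥ σ.N *ᵥ σ.b = σ'.c ⬝ᵥ σ'.A *ᵥ σ'.N *ᵥ σ'.b := by
  -- Apply `v` for time `s`, then `0` for time `r`. One-sided derivatives at `r = 0` and then `s =
  -- 0` bring down `A` and `A + vN`.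
  have h1 : ∀ v, ∀ s ∈ Ici (0 : ℝ), ∀ r ∈ Ici (0 : ℝ),
      σ.c ⬝ᵥ flow σ 0 r *ᵥ flow σ v s *ᵥ σ.b = σ'.c ⬝ᵥ flow σ' 0 r *ᵥ flow σ' v s *ᵥ σ'.b := by
    intro v s hs r hr
    have h0 : 0 ≤ s + r := add_nonneg hs hr
    have ht : s + r ∈ Icc 0 (stepInput s r v 0 h0).T := ⟨h0, le_rfl⟩
    have e := h (stepInput s r v 0 h0) (mem_univ _) (s + r) ht
    rw [output_step σ hs (fun _ _ => rfl) ht, output_step σ' hs (fun _ _ => rfl) ht] at e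
    simpa [max_eq_left (mem_Ici.1 hr), min_eq_right (le_add_of_nonneg_right (mem_Ici.1 hr))]
      using e
  have h2 : ∀ v, ∀ s ∈ Ici (0 : ℝ),
      σ.c ⬝ᵥ σ.A *ᵥ flow σ v s *ᵥ σ.b = σ'.c ⬝ᵥ σ'.A *ᵥ flow σ' v s *ᵥ σ'.b := by
    intro v s hs
    simpa using eq_of_hasDerivAt_of_eqOn_Ici (hasDerivAt_dotProduct_flow σ 0 _ _)
      (hasDerivAt_dotProduct_flow σ' 0 _ _) (h1 v s hs)
  have h3 : ∀ v : ℝ, σ.c ⬝ᵥ σ.A *ᵥ (σ.A + v • σ.N) *ᵥ σ.b =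
      σ'.c ⬝ᵥ σ'.A *ᵥ (σ'.A + v • σ'.N) *ᵥ σ'.b := by
    intro v
    have e1 := hasDerivAt_dotProduct_flow σ v (σ.c ᵥ* σ.A) σ.b
    have e2 := hasDerivAt_dotProduct_flow σ' v (σ'.c ᵥ* σ'.A) σ'.b
    simp only [← dotProduct_mulVec] at e1 e2
    exact eq_of_hasDerivAt_of_eqOn_Ici e1 e2 (h2 v)
  -- The identity is affine in `v`; its slope is the coefficient sought.
  have e0 := h3 0
  have e1 := h3 1
  simp only [zero_smul, add_zero, one_smul, add_mulVec, mulVec_add, dotProduct_add] at e0 e1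
  linarith

/-! ### The transposed partner -/

/-- The transposed system, corrected by the flow up to the time `τ` under the input `α`. -/
noncomputable def twin (τ α : ℝ) (σ : FourTuple n) : FourTuple n :=
  (σ.Aᵀ, σ.Nᵀ, σ.c ᵥ* flow σ α (-τ), flow σ α τ *ᵥ σ.b)

section Twin

variable (τ α : ℝ) (σ : FourTuple n)

@[simp] theorem twin_A : (twin τ α σ).A = σ.Aᵀ := rfl

@[simp] theorem twin_N : (twin τ α σ).N = σ.Nᵀ := rfl

@[simp] theorem twin_b : (twin τ α σ).b = σ.c ᵥ* flow σ α (-τ) := rfl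

@[simp] theorem twin_c : (twin τ α σ).c = flow σ α τ *ᵥ σ.b := rfl

@[simp]
theorem flow_twin (v t : ℝ) : flow (twin τ α σ) v t = (flow σ v t)ᵀ := by
  rw [flow, flow, ← Matrix.exp_transpose]
  simp

theorem twin_twin : twin τ α (twin τ α σ) = σ := by
  have h : flow σ α (-τ) * flow σ α τ = 1 := by rw [← flow_add]; simp
  have hb : (twin τ α (twin τ α σ)).b = σ.b := by
    simp [vecMul_transpose, h]
  have hc : (twin τ α (twin τ α σ)).c = σ.c := by
    simp [mulVec_transpose, h]
  exact Prod.ext rfl (Prod.ext rfl (Prod.ext hb hc))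

/-- A scalar equals its transpose, so `A` and `N` swap places; this swap is what can separate the
two systems. -/
theorem coeff_twin : (twin τ α σ).c ⬝ᵥ (twin τ α σ).A *ᵥ (twin τ α σ).N *ᵥ (twin τ α σ).b =
    σ.c ⬝ᵥ (flow σ α (-τ) * σ.N * σ.A * flow σ α τ) *ᵥ σ.b := by
  simp only [twin_A, twin_N, twin_b, twin_c, mulVec_transpose, dotProduct_mulVec, vecMul_vecMul]
  rw [dotProduct_comm, ← dotProduct_mulVec, dotProduct_mulVec, dotProduct_mulVec]
  simp [Matrix.mul_assoc]

theorem ioEquivOn_twin (hτ : 0 ≤ τ) : IOEquivOn (pulses τ α) σ (twin τ α σ) := by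
  rintro u ⟨-, β, hu⟩ t ht
  rw [output_step σ hτ hu ht, output_step _ hτ hu ht]
  simp only [flow_twin, twin_b, twin_c, mulVec_transpose, vecMul_vecMul]
  rw [dotProduct_comm (flow σ α τ *ᵥ σ.b), dotProduct_mulVec, dotProduct_mulVec,
    dotProduct_mulVec, vecMul_vecMul, vecMul_vecMul]
  congr 2
  -- Up to `τ` all three flows use the same matrix and commute; after `τ` the flows over `-τ` and
  -- `τ` cancel.
  rcases le_total t τ with h | h
  · rw [max_eq_right (sub_nonpos.2 h), min_eq_left h, flow_zero, mul_one, one_mul, ← flow_add,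
      ← flow_add]
    congr 1
    ring
  · rw [min_eq_right h, ← flow_add σ α (-τ)]
    simp

end Twin

/-- Both terms have the form `c P b`, with `P` a product of analytic matrix functions of the system.
-/
theorem analyticOnNhd_coeff_sub_coeff_twin (τ α : ℝ) :
    AnalyticOnNhd ℝ (fun σ : FourTuple n => σ.c ⬝ᵥ σ.A *ᵥ σ.N *ᵥ σ.b -
      (twin τ α σ).c ⬝ᵥ (twin τ α σ).A *ᵥ (twin τ α σ).N *ᵥ (twin τ α σ).b) univ := by
  open scoped Matrix.Norms.Operator in
  intro σ _
  have hA : AnalyticAt ℝ (fun σ : FourTuple n => σ.A) σ :=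
    (LinearMap.toContinuousLinearMap
      ({ toFun := FourTuple.A, map_add' := fun _ _ => rfl, map_smul' := fun _ _ => rfl } :
        FourTuple n →ₗ[ℝ] Matrix (Fin n) (Fin n) ℝ)).analyticAt σ
  have hN : AnalyticAt ℝ (fun σ : FourTuple n => σ.N) σ :=
    (LinearMap.toContinuousLinearMap
      ({ toFun := FourTuple.N, map_add' := fun _ _ => rfl, map_smul' := fun _ _ => rfl } :
        FourTuple n →ₗ[ℝ] Matrix (Fin n) (Fin n) ℝ)).analyticAt σ
  have hb : ∀ i, AnalyticAt ℝ (fun σ : FourTuple n => σ.b i) σ := fun i =>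
    (LinearMap.toContinuousLinearMap
      ({ toFun := fun σ => σ.b i, map_add' := fun _ _ => rfl, map_smul' := fun _ _ => rfl } :
        FourTuple n →ₗ[ℝ] ℝ)).analyticAt σ
  have hc : ∀ i, AnalyticAt ℝ (fun σ : FourTuple n => σ.c i) σ := fun i =>
    (LinearMap.toContinuousLinearMap
      ({ toFun := fun σ => σ.c i, map_add' := fun _ _ => rfl, map_smul' := fun _ _ => rfl } :
        FourTuple n →ₗ[ℝ] ℝ)).analyticAt σ
  have hflow : ∀ t, AnalyticAt ℝ (fun σ : FourTuple n => flow σ α t) σ := fun t =>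
    (NormedSpace.exp_analytic (𝕂 := ℝ) (t • (σ.A + α • σ.N))).fun_comp
      (f := fun σ : FourTuple n => t • (σ.A + α • σ.N))
      ((hA.add (hN.const_smul (c := α))).const_smul (c := t))
  have hform : ∀ P : FourTuple n → Matrix (Fin n) (Fin n) ℝ, AnalyticAt ℝ P σ →
      AnalyticAt ℝ (fun σ => σ.c ⬝ᵥ P σ *ᵥ σ.b) σ := by
    intro P hP
    simp only [dotProduct, mulVec]
    refine Finset.analyticAt_fun_sum _ fun i _ => (hc i).mul
      (Finset.analyticAt_fun_sum _ fun j _ => AnalyticAt.mul ?_ (hb j))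
    exact ((LinearMap.toContinuousLinearMap
      (Matrix.entryLinearMap ℝ ℝ i j)).analyticAt (P σ)).fun_comp hP
  simp only [coeff_twin]
  simp only [mulVec_mulVec]
  exact (hform _ (hA.mul hN)).sub (hform _ ((((hflow _).mul hN).mul hA).mul (hflow _)))

theorem exists_coeff_ne_coeff_twin (hn : 2 ≤ n) (τ α : ℝ) :
    ∃ σ : FourTuple n, σ.c ⬝ᵥ σ.A *ᵥ σ.N *ᵥ σ.b ≠
      (twin τ α σ).c ⬝ᵥ (twin τ α σ).A *ᵥ (twin τ α σ).N *ᵥ (twin τ α σ).b := by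
  let i : Fin n := ⟨0, by omega⟩
  let j : Fin n := ⟨1, by omega⟩
  have hij : i ≠ j := by simp [i, j]
  let d : Matrix (Fin n) (Fin n) ℝ := diagonal (Pi.single j 1)
  let e : Matrix (Fin n) (Fin n) ℝ := Matrix.single i j 1
  -- Subtracting `α • e` makes `A + αN` the diagonal `d` for every `α`, so the flow is explicit.
  -- Since `d` kills the `i`-th basis vector and fixes the `j`-th, the two coefficients are `0` and
  -- `exp τ`.
  let σ : FourTuple n := (d - α • e, e, Pi.single j 1, Pi.single i 1)
  have hA : σ.A = d - α • e := rfl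
  have hN : σ.N = e := rfl
  have hb : σ.b = Pi.single j 1 := rfl
  have hc : σ.c = Pi.single i 1 := rfl
  have hflow : ∀ t, flow σ α t = diagonal (exp (t • Pi.single j 1)) := by
    intro t
    rw [flow, hA, hN, sub_add_cancel, ← diagonal_smul, Matrix.exp_diagonal]
  have h1 : ∀ t, flow σ α t *ᵥ σ.b = Real.exp t • σ.b := by
    intro t
    rw [hflow, hb]
    ext k
    by_cases hk : k = j
    · subst hk
      simp [mulVec_diagonal, Pi.coe_exp, Real.exp_eq_exp_ℝ]
    · simp [mulVec_diagonal, hk]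
  have h2 : ∀ t, σ.c ᵥ* flow σ α t = σ.c := by
    intro t
    rw [hflow, hc]
    ext k
    by_cases hk : k = i
    · subst hk
      simp [vecMul_diagonal, Pi.coe_exp, hij]
    · simp [vecMul_diagonal, hk]
  refine ⟨σ, ?_⟩
  rw [coeff_twin]
  simp only [← mulVec_mulVec]
  rw [h1, dotProduct_mulVec _ (flow σ α (-τ)), h2, hA, hN, hb, hc]
  have hd : d *ᵥ Pi.single j 1 = Pi.single j 1 := by
    ext k; simp [d, Pi.single_apply]
  have hd' : d *ᵥ Pi.single i 1 = 0 := by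
    ext k; simp [d, hij]
  have he : e *ᵥ Pi.single j 1 = Pi.single i 1 := by
    ext k; simp [e, Pi.single_apply, Matrix.single_apply, eq_comm]
  have he' : e *ᵥ Pi.single i 1 = 0 := by
    ext k; simp [e, hij.symm]
  simp only [sub_mulVec, smul_mulVec, mulVec_smul, mulVec_sub, hd, hd', he, he']
  simp [(Real.exp_pos τ).ne]

end Bilinear

theorem theorem2 (n : ℕ) (hn : 2 ≤ n) (τ α : ℝ) (hτ : 0 ≤ τ) :
    ∃ G : Set (Bilinear.FourTuple n), Bilinear.IsGeneric G ∧
      ∀ σ ∈ G, ∃ σ' ∈ G,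
        Bilinear.IOEquivOn (Bilinear.pulses τ α) σ σ' ∧ ¬ Bilinear.IOEquiv σ σ' := by
  obtain ⟨σ₀, h₀⟩ := Bilinear.exists_coeff_ne_coeff_twin hn τ α
  refine ⟨_, Bilinear.isGeneric_of_analytic
    (Bilinear.analyticOnNhd_coeff_sub_coeff_twin τ α) (sub_ne_zero.2 h₀), fun σ hσ =>
    ⟨Bilinear.twin τ α σ, ?_, Bilinear.ioEquivOn_twin τ α σ hτ, fun h => hσ ?_⟩⟩
  -- Passing to the partner only changes the sign of the difference.
  · rw [mem_ofPred_eq, Bilinear.twin_twin, sub_ne_zero]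
    exact (sub_ne_zero.1 hσ).symm
  · exact sub_eq_zero.2 h.coeff_eq
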